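/- Let $\mathcal X$ be a measurable space and let $\mathbb C$ be a set of measurable functions $\mathcal X\to\{0,1\}$ (concepts) of VC dimension $d$ with $1\le d<\infty$. Assume, as the measurability condition on $\mathbb C$, that for every probability measure $\mathcal P$ on $\mathcal X$, every $n$ and every $y\in\{0,1\}^n$, the set of the $(x_1,\dots,x_n)\in\mathcal X^n$ for which some $h\in\mathbb C$ has $h(x_i)=y_i$ for all $i\le n$ is measurable up to a $\mathcal P^{n}$-null set. For a probability measure $\mathcal P$ on $\mathcal X$ and a sequence $\boldsymbol\Delta=\{\Delta_t\}_{t=2}^\infty$ in $[0,1]$, let $S_{\boldsymbol\Delta}$ be the set of all sequences $\mathbf h^*=\{h^*_t\}_{t=1}^\infty$ in $\mathbb C$ with $\mathcal P(x: h^*_t(x)\ne h^*_{t+1}(x))\le\Delta_{t+1}$ for every $t\ge 1$. Let $X_1,X_2,\dots$ be independent with distribution $\mathcal P$, and let $Y_t=h^*_t(X_t)$. A learning algorithm produces, at each time $t\geq 1$, a classifier $\hat h_t:\mathcal X\to\{0,1\}$ that is a function of $(X_1,Y_1),\dots,(X_{t-1},Y_{t-1})$ only, and predicts $\hat Y_t=\hat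 h_t(X_t)$. If $\sum_{t=2}^T\Delta_t=o(T)$ as $T\to\infty$, then there exists a learning algorithm (which may depend on $\mathbb C$ and $\boldsymbol\Delta$, but not on $\mathcal P$ or $\mathbf h^*$) such that, for every probability measure $\mathcal P$ on $\mathcal X$ and every $\mathbf h^*\in S_{\boldsymbol\Delta}$, each event $\{\hat Y_t\neq Y_t\}$ is measurable up to a null set and $$\mathbb E\left[\sum_{t=1}^T \mathbb 1[\hat Y_t\ne Y_t]\right]=o(T)\quad\text{as } T\to\infty .$$ -/

import Mathlib

open MeasureTheory Filter Asymptotics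

noncomputable section

namespace DriftingConcept

/-- A finite set `s` of instances is shattered by the concept space `C` if every labelling of `s`
is realized by some concept of `C`. -/
def Shatters {𝒳 : Type*} (C : Set (𝒳 → Bool)) (s : Finset 𝒳) : Prop :=
  ∀ y : 𝒳 → Bool, ∃ h ∈ C, ∀ x ∈ s, h x = y x

/-- The Vapnik-Chervonenkis dimension of a concept space: the supremum of the sizes of the finite
sets that it shatters. -/
def vcDim {𝒳 : Type*} (C : Set (𝒳 → Bool)) : ℕ∞ :=
  ⨆ (s : Finset 𝒳) (_ : Shatters C s), (s.card : ℕ∞)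

/-- The measurability condition on a concept space: for every probability measure `P`, the set of
the `n`-tuples of instances on which a given pattern of labels is realized by some concept is
measurable up to a null set of the product measure `P ^ n`. (It holds for countable classes of
measurable concepts, for pointwise separable ones, and for jointly measurable families indexed by
a Polish space, as the sets in question are then analytic.) -/
def HasMeasurableTraces {𝒳 : Type*} [MeasurableSpace 𝒳] (C : Set (𝒳 → Bool)) : Prop :=
  ∀ (P : Measure 𝒳) [IsProbabilityMeasure P] (n : ℕ) (y : Fin n → Bool),
    NullMeasurableSet {x : Fin n → 𝒳 | ∃ h ∈ C, ∀ i, h (x i) = y i} (Measure.pi fun _ => P)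

/-- The target sequences `h 1, h 2, …` in `C` whose drift from time `t` to time `t + 1` is at most
`Δ (t + 1)`, for every `t ≥ 1`. (The value `h 0` is not used.) -/
def driftSequences {𝒳 : Type*} [MeasurableSpace 𝒳] (C : Set (𝒳 → Bool)) (P : Measure 𝒳)
    (Δ : ℕ → ℝ) : Set (ℕ → 𝒳 → Bool) :=
  {h | ∀ t, 1 ≤ t → h t ∈ C ∧ P.real {x | h t x ≠ h (t + 1) x} ≤ Δ (t + 1)}

/-- A (passive, deterministic) learning algorithm: from `n` labelled observations it produces a
classifier. -/
abbrev LearningAlgorithm (𝒳 : Type*) : Type _ :=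
  (n : ℕ) → (Fin n → 𝒳 × Bool) → 𝒳 → Bool

/-- The law of the i.i.d. `P`-distributed instances; the instance of round `t ≥ 1` is the
coordinate `X t`. (The coordinate `X 0` is not used.) -/
def dataLaw {𝒳 : Type*} [MeasurableSpace 𝒳] (P : Measure 𝒳) [IsProbabilityMeasure P] :
    Measure (ℕ → 𝒳) :=
  Measure.infinitePi fun _ => P

/-- The observations `(X 1, Y 1), …, (X (t - 1), Y (t - 1))` available at round `t ≥ 1`, where
`Y s = h s (X s)`. -/
def history {𝒳 : Type*} (h : ℕ → 𝒳 → Bool) (X : ℕ → 𝒳) (t : ℕ) : Fin (t - 1) → 𝒳 × Bool :=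
  fun i => (X (i + 1), h (i + 1) (X (i + 1)))

/-- The prediction for the label of `X t` at round `t ≥ 1`. -/
def prediction {𝒳 : Type*} (A : LearningAlgorithm 𝒳) (h : ℕ → 𝒳 → Bool) (X : ℕ → 𝒳) (t : ℕ) :
    Bool :=
  A (t - 1) (history h X t) (X t)

/-- The event that the algorithm makes a mistake at round `t ≥ 1`. -/
def mistakeEvent {𝒳 : Type*} (A : LearningAlgorithm 𝒳) (h : ℕ → 𝒳 → Bool) (t : ℕ) :
    Set (ℕ → 𝒳) :=
  {X | prediction A h X t ≠ h t (X t)}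

/-- The number of mistakes in the rounds `1, …, T`. -/
def numMistakes {𝒳 : Type*} (A : LearningAlgorithm 𝒳) (h : ℕ → 𝒳 → Bool) (T : ℕ)
    (X : ℕ → 𝒳) : ℝ :=
  ∑ t ∈ Finset.Icc 1 T, (mistakeEvent A h t).indicator (fun _ => (1 : ℝ)) X

end DriftingConcept

end

/-!
The learner predicts from the `m` most recent observations by means of the one-inclusion graph of
Haussler, Littlestone and Warmuth. If `m` is fixed and the target did not move in the window, then a
mistake has probability at most `2 * d / (m + 1)`, where `d` bounds the sizes of the shattered sets;
the probability that the target sequence disagrees with the current target somewhere in the window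
is at most `m` times the drift of the last `m` steps. Summed over the rounds up to `T`, the second
term is at most `m ^ 2` times the total drift, which is `o(T)`, so the average number of mistakes is
at most `2 * d / (m + 1) + o(1)`. As the sequence `Δ` is known, the learner can take in each round
the `m` for which the sum of the two terms is least, and it then satisfies these bounds for all `m`
at once (`isLittleO_sum_of_le_windowRisk`).

For the first term, let `V` be the set of the label patterns that concepts realize on the `m + 1`
instances of the window and the current round. As a subgraph of the cube, `V` and every subset of it
has at most `d` edges per vertex (`card_lowerEdges_le`), hence a vertex of degree at most `2 * d`.
Deleting repeatedly all vertices of such degree exhausts `V`. The learner predicts the label whose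
pattern survives longer, so it errs at an instance only if the neighbour of the true pattern in this
direction survives at least as long as the true pattern, and there are at most `2 * d` such
directions (`card_leaves_le`). Since the peeling commutes with permutations of the instances, each
of the `m + 1` directions has the same probability (`measureReal_leaves_last_le`).

The prediction depends on the instances only through `V` and the labels, which is why measurability
of the traces suffices for the measurability of the mistakes (`nullMeasurableSet_patterns`).
-/

noncomputable section

namespace DriftingConcept

open Finset

/-! ### One-inclusion graphs and their peeling -/

section Combinatorics

variable {ι : Type*} [DecidableEq ι]

/-- The edges of the one-inclusion graph of a family `𝒜`, i.e. of the subgraph of the cube induced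
on `𝒜`: the edge in direction `a` is recorded at its lower end `s`, as the pair `(s, a)`. -/
def lowerEdges [Fintype ι] (𝒜 : Finset (Finset ι)) : Finset (Finset ι × ι) :=
  {p | p.2 ∉ p.1 ∧ p.1 ∈ 𝒜 ∧ insert p.2 p.1 ∈ 𝒜}

lemma mem_lowerEdges [Fintype ι] {𝒜 : Finset (Finset ι)} {p : Finset ι × ι} :
    p ∈ lowerEdges 𝒜 ↔ p.2 ∉ p.1 ∧ p.1 ∈ 𝒜 ∧ insert p.2 p.1 ∈ 𝒜 := by
  simp [lowerEdges]

/-- An edge of either family is an edge of the union, and an edge of both is one of the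
intersection as well. The inequality may be strict, as the union can have edges between the two
families. -/
lemma card_lowerEdges_add_le [Fintype ι] (ℬ 𝒞 : Finset (Finset ι)) :
    #(lowerEdges ℬ) + #(lowerEdges 𝒞) ≤ #(lowerEdges (ℬ ∪ 𝒞)) + #(lowerEdges (ℬ ∩ 𝒞)) := by
  have hi : lowerEdges (ℬ ∩ 𝒞) = lowerEdges ℬ ∩ lowerEdges 𝒞 := by
    ext p
    simp only [mem_lowerEdges, mem_inter]
    tauto
  rw [hi, ← card_union_add_card_inter]
  gcongr
  intro p
  simp only [mem_lowerEdges, mem_union]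
  tauto

lemma card_lowerEdges_le_member [Fintype ι] (a : ι) (𝒜 : Finset (Finset ι)) :
    #(lowerEdges 𝒜) ≤ #(lowerEdges (𝒜.nonMemberSubfamily a)) + #(lowerEdges (𝒜.memberSubfamily a))
      + #(𝒜.nonMemberSubfamily a ∩ 𝒜.memberSubfamily a) := by
  have hsub : lowerEdges 𝒜 ⊆ lowerEdges (𝒜.nonMemberSubfamily a) ∪
      (lowerEdges (𝒜.memberSubfamily a)).image (fun p => (insert a p.1, p.2)) ∪
      (𝒜.nonMemberSubfamily a ∩ 𝒜.memberSubfamily a).image (fun s => (s, a)) := by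
    rintro ⟨s, b⟩ hp
    simp only [mem_lowerEdges] at hp
    obtain ⟨hb, hs, hbs⟩ := hp
    simp only [mem_union, mem_image, mem_lowerEdges, mem_nonMemberSubfamily, mem_memberSubfamily,
      mem_inter, Prod.mk.injEq, Prod.exists]
    by_cases hba : b = a
    · subst hba
      exact Or.inr ⟨s, ⟨⟨hs, hb⟩, hbs, hb⟩, rfl, rfl⟩
    by_cases has : a ∈ s
    · refine Or.inl (Or.inr ⟨s.erase a, b, ⟨?_, ⟨?_, ?_⟩, ?_, ?_⟩, ?_, rfl⟩)
      · simp [hb]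
      · rwa [insert_erase has]
      · simp
      · rw [insert_comm, insert_erase has]
        exact hbs
      · simp [Ne.symm hba]
      · exact insert_erase has
    · refine Or.inl (Or.inl ⟨hb, ⟨hs, has⟩, hbs, ?_⟩)
      simp [has, Ne.symm hba]
  calc #(lowerEdges 𝒜) ≤ _ := card_le_card hsub
    _ ≤ _ := (card_union_le _ _).trans
      (Nat.add_le_add ((card_union_le _ _).trans (Nat.add_le_add le_rfl card_image_le))
        card_image_le)

/-- The one-inclusion graph of a family that shatters no set of more than `d` points has at most
`d` times as many edges as vertices. -/
lemma card_lowerEdges_le [Fintype ι] {d : ℕ} {𝒜 : Finset (Finset ι)}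
    (h𝒜 : ∀ s, 𝒜.Shatters s → #s ≤ d) : #(lowerEdges 𝒜) ≤ d * #𝒜 := by
  suffices h : ∀ (u : Finset ι) (d : ℕ) (𝒜 : Finset (Finset ι)), (∀ s ∈ 𝒜, s ⊆ u) →
      (∀ s, 𝒜.Shatters s → #s ≤ d) → #(lowerEdges 𝒜) ≤ d * #𝒜 from
    h univ d 𝒜 (fun s _ => subset_univ s) h𝒜
  clear h𝒜 𝒜 d
  intro u
  induction u using Finset.induction_on with
  | empty =>
    intro d 𝒜 hu _
    suffices h : lowerEdges 𝒜 = ∅ by simp [h]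
    ext ⟨s, a⟩
    simp only [mem_lowerEdges, notMem_empty, iff_false]
    rintro ⟨-, -, h⟩
    exact notMem_empty a (hu _ h (mem_insert_self a s))
  | insert a u _ ih =>
    intro d 𝒜 hu hd
    set ℬ := 𝒜.nonMemberSubfamily a with hℬ
    set 𝒞 := 𝒜.memberSubfamily a with h𝒞
    have hℬ' : ∀ s, s ∈ ℬ ↔ s ∈ 𝒜 ∧ a ∉ s := fun s => mem_nonMemberSubfamily
    have h𝒞' : ∀ s, s ∈ 𝒞 ↔ insert a s ∈ 𝒜 ∧ a ∉ s := fun s => mem_memberSubfamily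
    have huℬ : ∀ s ∈ ℬ, s ⊆ u := fun s hs =>
      (subset_insert_iff_of_notMem ((hℬ' s).1 hs).2).1 (hu s ((hℬ' s).1 hs).1)
    have hu𝒞 : ∀ s ∈ 𝒞, s ⊆ u := fun s hs =>
      (subset_insert_iff_of_notMem ((h𝒞' s).1 hs).2).1
        ((subset_insert a s).trans (hu _ ((h𝒞' s).1 hs).1))
    have hunion : ∀ s, (ℬ ∪ 𝒞).Shatters s → #s ≤ d := by
      intro s hs
      have has : a ∉ s := by
        intro ha
        obtain ⟨t, ht, hst⟩ := hs (Subset.refl s)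
        have : a ∈ t := (mem_inter.1 (hst.symm ▸ ha)).2
        rcases mem_union.1 ht with h | h
        · exact ((hℬ' t).1 h).2 this
        · exact ((h𝒞' t).1 h).2 this
      refine hd s fun t hts => ?_
      obtain ⟨v, hv, hsv⟩ := hs hts
      rcases mem_union.1 hv with h | h
      · exact ⟨v, ((hℬ' v).1 h).1, hsv⟩
      · exact ⟨insert a v, ((h𝒞' v).1 h).1, by rw [inter_insert_of_notMem has, hsv]⟩
    have hinter : ∀ s, (ℬ ∩ 𝒞).Shatters s → #s + 1 ≤ d := by
      intro s hs
      have has : a ∉ s := by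
        intro ha
        obtain ⟨t, ht, hst⟩ := hs (Subset.refl s)
        exact ((hℬ' t).1 (mem_inter.1 ht).1).2 (mem_inter.1 (hst.symm ▸ ha)).2
      rw [← card_insert_of_notMem has]
      refine hd _ fun t hts => ?_
      obtain ⟨v, hv, hsv⟩ := hs (t := t.erase a) (subset_insert_iff.1 hts)
      rw [mem_inter, hℬ', h𝒞'] at hv
      by_cases hat : a ∈ t
      · exact ⟨insert a v, hv.2.1, by rw [← insert_inter_distrib, hsv, insert_erase hat]⟩
      · exact ⟨v, hv.1.1, by rw [insert_inter_of_notMem hv.1.2, hsv, erase_eq_of_notMem hat]⟩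
    have h1 : #(lowerEdges (ℬ ∪ 𝒞)) ≤ d * #(ℬ ∪ 𝒞) :=
      ih d _ (fun s hs => (mem_union.1 hs).elim (huℬ s) (hu𝒞 s)) hunion
    have h2 : #(lowerEdges (ℬ ∩ 𝒞)) + #(ℬ ∩ 𝒞) ≤ d * #(ℬ ∩ 𝒞) := by
      rcases (ℬ ∩ 𝒞).eq_empty_or_nonempty with he | hne
      · rw [he]
        simp [lowerEdges]
      have hd1 : 1 ≤ d := by simpa using hinter ∅ (shatters_empty.2 hne)
      have := ih (d - 1) (ℬ ∩ 𝒞) (fun s hs => huℬ s (mem_inter.1 hs).1)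
        (fun s hs => Nat.le_sub_one_of_lt (hinter s hs))
      obtain ⟨e, rfl⟩ := Nat.exists_eq_add_of_le' hd1
      rw [Nat.add_sub_cancel] at this
      linarith
    have h3 : #𝒞 + #ℬ = #𝒜 := card_memberSubfamily_add_card_nonMemberSubfamily a 𝒜
    have h4 := card_union_add_card_inter ℬ 𝒞
    have h5 := card_lowerEdges_add_le ℬ 𝒞
    have h6 : #(lowerEdges 𝒜) ≤ #(lowerEdges ℬ) + #(lowerEdges 𝒞) + #(ℬ ∩ 𝒞) :=
      card_lowerEdges_le_member a 𝒜
    have h7 : d * #𝒜 = d * #(ℬ ∪ 𝒞) + d * #(ℬ ∩ 𝒞) := by rw [← mul_add, h4, ← h3, add_comm]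
    omega

/-- The directions of the edges of the one-inclusion graph of `𝒜` at the vertex `s`. -/
def directions [Fintype ι] (𝒜 : Finset (Finset ι)) (s : Finset ι) : Finset ι :=
  {i | symmDiff s {i} ∈ 𝒜}

lemma mem_directions [Fintype ι] {𝒜 : Finset (Finset ι)} {s : Finset ι} {i : ι} :
    i ∈ directions 𝒜 s ↔ symmDiff s {i} ∈ 𝒜 := by
  simp [directions]

lemma symmDiff_singleton_of_mem {s : Finset ι} {i : ι} (h : i ∈ s) :
    symmDiff s {i} = s.erase i := by
  ext j
  by_cases hj : j = i <;> simp [mem_symmDiff, hj, h]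

lemma symmDiff_singleton_of_notMem {s : Finset ι} {i : ι} (h : i ∉ s) :
    symmDiff s {i} = insert i s := by
  ext j
  by_cases hj : j = i <;> simp [mem_symmDiff, hj, h]

lemma sum_card_directions_le [Fintype ι] (𝒜 : Finset (Finset ι)) :
    ∑ s ∈ 𝒜, #(directions 𝒜 s) ≤ 2 * #(lowerEdges 𝒜) := by
  rw [← card_sigma, two_mul]
  have hsub : (𝒜.sigma fun s => directions 𝒜 s) ⊆
      (lowerEdges 𝒜).image (fun p => (⟨p.1, p.2⟩ : (_ : Finset ι) × ι)) ∪
      (lowerEdges 𝒜).image (fun p => (⟨insert p.2 p.1, p.2⟩ : (_ : Finset ι) × ι)) := by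
    rintro ⟨s, i⟩ h
    obtain ⟨hs, hi⟩ := mem_sigma.1 h
    simp only [mem_directions] at hs hi
    by_cases his : i ∈ s
    · rw [symmDiff_singleton_of_mem his] at hi
      refine mem_union_right _ (mem_image.2 ⟨(s.erase i, i), mem_lowerEdges.2 ?_, ?_⟩)
      · simp [hi, insert_erase his, hs]
      · simp [insert_erase his]
    · rw [symmDiff_singleton_of_notMem his] at hi
      exact mem_union_left _ (mem_image.2 ⟨(s, i), mem_lowerEdges.2 ⟨his, hs, hi⟩, rfl⟩)
  exact (card_le_card hsub).trans
    ((card_union_le _ _).trans (Nat.add_le_add card_image_le card_image_le))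

/-- The peeling of the one-inclusion graph of `𝒜`: each step deletes, all at once, the vertices of
degree at most `2 * d` of the graph that is left. As no vertices are chosen, the construction does
not depend on an order of the coordinates. -/
def peel [Fintype ι] (d : ℕ) (𝒜 : Finset (Finset ι)) : ℕ → Finset (Finset ι)
  | 0 => 𝒜
  | k + 1 => {s ∈ peel d 𝒜 k | 2 * d < #(directions (peel d 𝒜 k) s)}

lemma peel_zero [Fintype ι] (d : ℕ) (𝒜 : Finset (Finset ι)) : peel d 𝒜 0 = 𝒜 := rfl

lemma mem_peel_succ [Fintype ι] {d k : ℕ} {𝒜 : Finset (Finset ι)} {s : Finset ι} :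
    s ∈ peel d 𝒜 (k + 1) ↔ s ∈ peel d 𝒜 k ∧ 2 * d < #(directions (peel d 𝒜 k) s) := by
  simp [peel]

lemma peel_antitone [Fintype ι] (d : ℕ) (𝒜 : Finset (Finset ι)) : Antitone (peel d 𝒜) :=
  antitone_nat_of_succ_le fun _ _ hs => (mem_peel_succ.1 hs).1

/-- If `𝒜` shatters no set of more than `d` points, then no vertex survives the peeling, because
the average degree of every induced subgraph is at most `2 * d`. -/
lemma exists_notMem_peel [Fintype ι] {d : ℕ} {𝒜 : Finset (Finset ι)}
    (h𝒜 : ∀ s, 𝒜.Shatters s → #s ≤ d) (v : Finset ι) : ∃ k, v ∉ peel d 𝒜 k := by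
  suffices h : ∀ k, #(peel d 𝒜 k) + k ≤ #𝒜 ∨ peel d 𝒜 k = ∅ by
    refine ⟨#𝒜 + 1, ?_⟩
    rcases h (#𝒜 + 1) with h | h
    · omega
    · simp [h]
  intro k
  induction k with
  | zero => simp [peel_zero]
  | succ k ih =>
    have hsub : peel d 𝒜 (k + 1) ⊆ peel d 𝒜 k := peel_antitone d 𝒜 k.le_succ
    rcases ih with ih | ih
    swap
    · exact Or.inr (subset_empty.1 (ih ▸ hsub))
    rcases (peel d 𝒜 k).eq_empty_or_nonempty with he | hne
    · exact Or.inr (subset_empty.1 (he ▸ hsub))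
    left
    suffices h : #(peel d 𝒜 (k + 1)) < #(peel d 𝒜 k) by omega
    refine card_lt_card (hsub.ssubset_of_ne fun heq => ?_)
    have hshat : ∀ s, (peel d 𝒜 k).Shatters s → #s ≤ d := fun s hs =>
      h𝒜 s (hs.mono_left (peel_antitone d 𝒜 k.zero_le))
    have hlt : ∑ _s ∈ peel d 𝒜 k, 2 * d < ∑ s ∈ peel d 𝒜 k, #(directions (peel d 𝒜 k) s) := by
      refine sum_lt_sum_of_nonempty hne fun s hs => ?_
      rw [← heq] at hs
      exact (mem_peel_succ.1 hs).2
    have := sum_card_directions_le (peel d 𝒜 k)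
    have := card_lowerEdges_le hshat
    rw [sum_const, smul_eq_mul] at hlt
    linarith

/-- The edge in direction `i` at `v` *leaves* `v` if its other end survives the peeling of `𝒜` at
least as long as `v` does. (An edge whose ends are deleted in the same step leaves both.) -/
def Leaves [Fintype ι] (d : ℕ) (𝒜 : Finset (Finset ι)) (v : Finset ι) (i : ι) : Prop :=
  ∀ k, v ∈ peel d 𝒜 k → symmDiff v {i} ∈ peel d 𝒜 k

open Classical in
/-- When `v` is about to be deleted, all the edges that leave it are present. -/
lemma card_leaves_le [Fintype ι] {d : ℕ} {𝒜 : Finset (Finset ι)}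
    (h𝒜 : ∀ s, 𝒜.Shatters s → #s ≤ d) {v : Finset ι} (hv : v ∈ 𝒜) :
    #{i | Leaves d 𝒜 v i} ≤ 2 * d := by
  have hex := exists_notMem_peel h𝒜 v
  obtain ⟨k, hk⟩ : ∃ k, Nat.find hex = k + 1 :=
    Nat.exists_eq_succ_of_ne_zero fun h0 => (h0 ▸ Nat.find_spec hex) hv
  have hvk : v ∈ peel d 𝒜 k := by
    by_contra h
    have := Nat.find_min' hex h
    omega
  have hvk' : v ∉ peel d 𝒜 (k + 1) := hk ▸ Nat.find_spec hex
  rw [mem_peel_succ, not_and, not_lt] at hvk'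
  refine (card_le_card fun i hi => ?_).trans (hvk' hvk)
  exact mem_directions.2 ((mem_filter.1 hi).2 k hvk)

lemma map_symmDiff_singleton (σ : Equiv.Perm ι) (s : Finset ι) (i : ι) :
    (symmDiff s {i}).map σ.toEmbedding = symmDiff (s.map σ.toEmbedding) {σ i} := by
  ext j
  simp [mem_symmDiff, mem_map_equiv, Equiv.symm_apply_eq]

lemma mem_peel_map_iff [Fintype ι] (σ : Equiv.Perm ι) {d : ℕ} {𝒜 ℬ : Finset (Finset ι)}
    (h : ∀ s, s ∈ 𝒜 ↔ s.map σ.toEmbedding ∈ ℬ) (k : ℕ) (s : Finset ι) :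
    s ∈ peel d 𝒜 k ↔ s.map σ.toEmbedding ∈ peel d ℬ k := by
  induction k generalizing s with
  | zero => exact h s
  | succ k ih =>
    rw [mem_peel_succ, mem_peel_succ, ← ih s]
    suffices hc : #(directions (peel d 𝒜 k) s) =
        #(directions (peel d ℬ k) (s.map σ.toEmbedding)) by rw [hc]
    refine card_equiv σ fun i => ?_
    rw [mem_directions, mem_directions, ih, map_symmDiff_singleton]

lemma leaves_map_iff [Fintype ι] (σ : Equiv.Perm ι) {d : ℕ} {𝒜 ℬ : Finset (Finset ι)}
    (h : ∀ s, s ∈ 𝒜 ↔ s.map σ.toEmbedding ∈ ℬ) (v : Finset ι) (i : ι) :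
    Leaves d 𝒜 v i ↔ Leaves d ℬ (v.map σ.toEmbedding) (σ i) := by
  refine forall_congr' fun k => ?_
  rw [mem_peel_map_iff σ h, mem_peel_map_iff σ h, map_symmDiff_singleton]

/-- The label predicted for the coordinate `i` when the labels of the other coordinates are those
of `s`: of the two extensions `insert i s` and `s.erase i`, the one that survives the peeling
longer, and the second one in case of a tie. -/
def PredictsTrue [Fintype ι] (d : ℕ) (𝒜 : Finset (Finset ι)) (s : Finset ι) (i : ι) : Prop :=
  ∃ k, insert i s ∈ peel d 𝒜 k ∧ s.erase i ∉ peel d 𝒜 k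

/-- A wrong prediction at `i`, when the true labels are `v`, comes from an edge that leaves `v`. -/
lemma leaves_of_predictsTrue_iff [Fintype ι] {d : ℕ} {𝒜 : Finset (Finset ι)} {v : Finset ι}
    {i : ι} (h : ¬ (PredictsTrue d 𝒜 v i ↔ i ∈ v)) : Leaves d 𝒜 v i := by
  intro k hk
  by_cases hi : i ∈ v
  · rw [symmDiff_singleton_of_mem hi]
    by_contra hne
    exact h (iff_of_true ⟨k, by rwa [insert_eq_of_mem hi], hne⟩ hi)
  · rw [symmDiff_singleton_of_notMem hi]
    obtain ⟨l, hl, hl'⟩ : PredictsTrue d 𝒜 v i := by tauto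
    rw [erase_eq_of_notMem hi] at hl'
    refine peel_antitone d 𝒜 ?_ hl
    by_contra! hlk
    exact hl' (peel_antitone d 𝒜 hlk.le hk)

end Combinatorics

/-! ### Patterns realized on random tuples -/

section Transductive

variable {𝒳 : Type*}

open Classical in
/-- The label patterns that concepts of `C` realize on the tuple `x`; a pattern is encoded as the
set of the coordinates with label `true`. -/
def realizedPatterns {n : ℕ} (C : Set (𝒳 → Bool)) (x : Fin n → 𝒳) : Finset (Finset (Fin n)) :=
  {s | ∃ h ∈ C, ∀ i, h (x i) = decide (i ∈ s)}

/-- The set of the coordinates with label `true`. -/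
def labelSet {n : ℕ} (y : Fin n → Bool) : Finset (Fin n) := {i | y i = true}

lemma mem_labelSet {n : ℕ} {y : Fin n → Bool} {i : Fin n} : i ∈ labelSet y ↔ y i = true := by
  simp [labelSet]

lemma mem_realizedPatterns {n : ℕ} {C : Set (𝒳 → Bool)} {x : Fin n → 𝒳} {s : Finset (Fin n)} :
    s ∈ realizedPatterns C x ↔ ∃ h ∈ C, ∀ i, h (x i) = decide (i ∈ s) := by
  simp [realizedPatterns]

lemma labelSet_mem_realizedPatterns {n : ℕ} {C : Set (𝒳 → Bool)} {g : 𝒳 → Bool} (hg : g ∈ C)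
    (x : Fin n → 𝒳) : labelSet (fun i => g (x i)) ∈ realizedPatterns C x :=
  mem_realizedPatterns.2 ⟨g, hg, fun i => by simp [mem_labelSet]⟩

lemma card_le_of_shatters_realizedPatterns {n d : ℕ} {C : Set (𝒳 → Bool)}
    (hd : ∀ s : Finset 𝒳, Shatters C s → #s ≤ d) (x : Fin n → 𝒳) (s : Finset (Fin n))
    (hs : (realizedPatterns C x).Shatters s) : #s ≤ d := by
  classical
  have hinj : Set.InjOn x s := by
    intro i hi j hj hij
    obtain ⟨u, hu, hsu⟩ := hs (t := {i}) (by simpa using hi)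
    obtain ⟨h, -, hh⟩ := mem_realizedPatterns.1 hu
    have hiu : i ∈ u := (mem_inter.1 (hsu.symm ▸ mem_singleton_self i)).2
    have hju : j ∈ u := by
      have := (hh i).symm.trans (hij ▸ hh j)
      simpa [hiu] using this
    have : j ∈ s ∩ u := mem_inter.2 ⟨hj, hju⟩
    rw [hsu, mem_singleton] at this
    exact this.symm
  rw [← card_image_of_injOn hinj]
  refine hd _ fun y => ?_
  obtain ⟨u, hu, hsu⟩ := hs (filter_subset (fun i => y (x i) = true) s)
  obtain ⟨h, hC, hh⟩ := mem_realizedPatterns.1 hu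
  refine ⟨h, hC, fun z hz => ?_⟩
  obtain ⟨i, hi, rfl⟩ := mem_image.1 hz
  have : i ∈ s ∩ u ↔ i ∈ s ∧ y (x i) = true := by rw [hsu, mem_filter]
  rw [hh i]
  simp only [mem_inter, hi, true_and] at this
  simp [this]

lemma mem_realizedPatterns_comp_iff {n : ℕ} {C : Set (𝒳 → Bool)} (σ : Equiv.Perm (Fin n))
    (x : Fin n → 𝒳) (s : Finset (Fin n)) :
    s ∈ realizedPatterns C (x ∘ σ) ↔ s.map σ.toEmbedding ∈ realizedPatterns C x := by
  rw [mem_realizedPatterns, mem_realizedPatterns]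
  refine exists_congr fun h => and_congr_right fun _ => ?_
  rw [← σ.forall_congr_right (q := fun i => h (x i) = decide (i ∈ s.map σ.toEmbedding))]
  simp

lemma labelSet_comp {n : ℕ} (σ : Equiv.Perm (Fin n)) (y : Fin n → Bool) :
    labelSet y = (labelSet (y ∘ σ)).map σ.toEmbedding := by
  ext i
  simp [mem_labelSet, mem_map_equiv]

variable [MeasurableSpace 𝒳]

/-- Under `HasMeasurableTraces`, any event that is determined by the realized patterns and by
measurable labels is measurable up to a null set: it is a finite union of finite intersections of
trace sets, their complements and measurable sets. -/
lemma nullMeasurableSet_patterns {n : ℕ} {C : Set (𝒳 → Bool)} (hC : HasMeasurableTraces C)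
    (P : Measure 𝒳) [IsProbabilityMeasure P] {g : Fin n → 𝒳 → Bool} (hg : ∀ i, Measurable (g i))
    (S : Set (Finset (Finset (Fin n)) × (Fin n → Bool))) :
    NullMeasurableSet {x : Fin n → 𝒳 | (realizedPatterns C x, fun i => g i (x i)) ∈ S}
      (Measure.pi fun _ => P) := by
  have hS : {x : Fin n → 𝒳 | (realizedPatterns C x, fun i => g i (x i)) ∈ S} =
      ⋃ p ∈ S, ({x | realizedPatterns C x = p.1} ∩ {x | (fun i => g i (x i)) = p.2}) := by
    ext x
    simp only [Set.mem_ofPred_eq, Set.mem_iUnion, Set.mem_inter_iff, exists_prop]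
    exact ⟨fun h => ⟨_, h, rfl, rfl⟩, fun ⟨p, hp, h1, h2⟩ => by rwa [h1, h2]⟩
  rw [hS]
  refine NullMeasurableSet.biUnion S.to_countable fun p _ => .inter ?_ ?_
  · have h1 : {x : Fin n → 𝒳 | realizedPatterns C x = p.1} =
        ⋂ s, {x | s ∈ realizedPatterns C x ↔ s ∈ p.1} := by
      ext x
      simp [Finset.ext_iff]
    rw [h1]
    refine NullMeasurableSet.iInter fun s => ?_
    have hs : NullMeasurableSet {x : Fin n → 𝒳 | s ∈ realizedPatterns C x}
        (Measure.pi fun _ => P) := by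
      simp only [mem_realizedPatterns]
      exact hC P n fun i => decide (i ∈ s)
    by_cases hp : s ∈ p.1
    · simpa only [hp, iff_true] using hs
    · simp only [hp, iff_false]
      exact hs.compl
  · refine MeasurableSet.nullMeasurableSet ?_
    have hm : Measurable fun (x : Fin n → 𝒳) i => g i (x i) :=
      measurable_pi_lambda _ fun i => (hg i).comp (measurable_pi_apply i)
    exact hm (measurableSet_singleton p.2)

lemma nullMeasurableSet_leaves {n d : ℕ} {C : Set (𝒳 → Bool)} (hC : HasMeasurableTraces C)
    (P : Measure 𝒳) [IsProbabilityMeasure P] {g : 𝒳 → Bool} (hg : Measurable g) (i : Fin n) :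
    NullMeasurableSet {x : Fin n → 𝒳 |
      Leaves d (realizedPatterns C x) (labelSet fun j => g (x j)) i} (Measure.pi fun _ => P) :=
  nullMeasurableSet_patterns hC P (g := fun _ => g) (fun _ => hg)
    {p | Leaves d p.1 (labelSet p.2) i}

/-- By exchangeability, the probability that the edge in direction `i` leaves the vertex of the true
labels does not depend on `i`; the expected number of these directions is at most `2 * d`. -/
lemma measureReal_leaves_last_le {n d : ℕ} {C : Set (𝒳 → Bool)} (hC : HasMeasurableTraces C)
    (hd : ∀ s : Finset 𝒳, Shatters C s → #s ≤ d)
    (P : Measure 𝒳) [IsProbabilityMeasure P] {g : 𝒳 → Bool} (hgC : g ∈ C) (hg : Measurable g) :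
    (Measure.pi fun _ : Fin (n + 1) => P).real {x |
      Leaves d (realizedPatterns C x) (labelSet fun j => g (x j)) (Fin.last n)} ≤
      2 * d / (n + 1) := by
  classical
  set μ := Measure.pi fun _ : Fin (n + 1) => P
  set E : Fin (n + 1) → Set (Fin (n + 1) → 𝒳) := fun i =>
    {x | Leaves d (realizedPatterns C x) (labelSet fun j => g (x j)) i} with hE
  have hEm : ∀ i, NullMeasurableSet (E i) μ := nullMeasurableSet_leaves hC P hg
  have hswap : ∀ i, μ.real (E i) = μ.real (E (Fin.last n)) := by
    intro i
    let σ : Equiv.Perm (Fin (n + 1)) := Equiv.swap i (Fin.last n)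
    have hmp : MeasurePreserving (fun x : Fin (n + 1) → 𝒳 => x ∘ σ) μ μ := by
      have := measurePreserving_piCongrLeft (fun _ : Fin (n + 1) => P) σ.symm
      convert this using 1
      ext x i
      simp [MeasurableEquiv.coe_piCongrLeft, Equiv.piCongrLeft_apply]
    have hpre : (fun x : Fin (n + 1) → 𝒳 => x ∘ σ) ⁻¹' E i = E (Fin.last n) := by
      ext x
      have h := leaves_map_iff σ (d := d) (mem_realizedPatterns_comp_iff (C := C) σ x)
        (labelSet fun j => g ((x ∘ σ) j)) i
      have hl := labelSet_comp σ fun j => g (x j)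
      simp only [hE, Set.mem_preimage, Set.mem_ofPred_eq]
      rw [h, hl, Equiv.swap_apply_left]
      rfl
    rw [← hpre, measureReal_def, measureReal_def, hmp.measure_preimage (hEm i)]
  have hint : ∀ i, Integrable ((E i).indicator fun _ => (1 : ℝ)) μ := fun i =>
    (integrable_const 1).indicator₀ (hEm i)
  have hsum : (n + 1 : ℝ) * μ.real (E (Fin.last n)) ≤ 2 * d := by
    calc (n + 1 : ℝ) * μ.real (E (Fin.last n)) = ∑ i, μ.real (E i) := by simp [hswap]
      _ = ∑ i, ∫ x, (E i).indicator (fun _ => (1 : ℝ)) x ∂μ := by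
        refine sum_congr rfl fun i _ => ?_
        rw [integral_indicator₀ (hEm i)]
        simp
      _ = ∫ x, ∑ i, (E i).indicator (fun _ => (1 : ℝ)) x ∂μ :=
        (integral_finsetSum _ fun i _ => hint i).symm
      _ ≤ ∫ _, (2 * d : ℝ) ∂μ := by
        refine integral_mono (integrable_finsetSum _ fun i _ => hint i) (integrable_const _)
          fun x => ?_
        have h := card_leaves_le (card_le_of_shatters_realizedPatterns hd x)
          (labelSet_mem_realizedPatterns hgC x)
        simp only [Set.indicator_apply, hE, Set.mem_ofPred_eq, sum_boole]
        exact_mod_cast h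
      _ = 2 * d := by simp
  rw [le_div_iff₀ (by positivity), mul_comm]
  exact hsum

/-- The coordinates of a window of the sequence of instances are again i.i.d. -/
lemma measurePreserving_window (P : Measure 𝒳) [IsProbabilityMeasure P] (k n : ℕ) :
    MeasurePreserving (fun (X : ℕ → 𝒳) (i : Fin n) => X (k + i)) (dataLaw P)
      (Measure.pi fun _ => P) := by
  classical
  have hm : Measurable fun (X : ℕ → 𝒳) (i : Fin n) => X (k + i) :=
    measurable_pi_lambda _ fun i => measurable_pi_apply _
  refine ⟨hm, (Measure.pi_eq fun s hs => ?_).symm⟩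
  rw [Measure.map_apply hm (MeasurableSet.univ_pi hs)]
  let e : Fin n ↪ ℕ := ⟨fun i => k + i, fun i j h => Fin.ext (by simpa using h)⟩
  have he : ∀ i : Fin n, e i = k + i := fun _ => rfl
  let t : ℕ → Set 𝒳 := fun j => if h : j - k < n then s ⟨j - k, h⟩ else Set.univ
  have ht : ∀ i : Fin n, t (k + i) = s i := fun i => by simp [t]
  have hpre : (fun (X : ℕ → 𝒳) (i : Fin n) => X (k + i)) ⁻¹' Set.univ.pi s =
      Set.pi (univ.map e : Finset ℕ) t := by
    ext X
    simp [Set.mem_pi, ht, he]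
  rw [hpre, dataLaw, Measure.infinitePi_pi, prod_map]
  · simp [he, ht]
  · intro j hj
    obtain ⟨i, -, rfl⟩ := Finset.mem_map.1 hj
    rw [he, ht]
    exact hs i

end Transductive

/-! ### The choice of the window -/

section Window

/-- A bound on the probability of a mistake at round `t` of the one-inclusion prediction from the
`m` most recent observations: a term for the prediction with a fixed target, and a term for the
event that the labels in the window do not agree with the current target. -/
def windowRisk (d : ℕ) (Δ : ℕ → ℝ) (t m : ℕ) : ℝ :=
  2 * d / (m + 1) + m * ∑ j ∈ range m, Δ (t - j)

lemma exists_windowLength (d : ℕ) (Δ : ℕ → ℝ) (n : ℕ) :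
    ∃ m ∈ range (n + 1), ∀ m' ∈ range (n + 1),
      windowRisk d Δ (n + 1) m ≤ windowRisk d Δ (n + 1) m' :=
  exists_min_image _ _ ⟨0, by simp⟩

/-- A window length, among those that `n` observations allow, with the least risk. -/
def windowLength (d : ℕ) (Δ : ℕ → ℝ) (n : ℕ) : ℕ :=
  (exists_windowLength d Δ n).choose

lemma windowLength_le (d : ℕ) (Δ : ℕ → ℝ) (n : ℕ) : windowLength d Δ n ≤ n :=
  Nat.lt_succ_iff.1 (mem_range.1 (exists_windowLength d Δ n).choose_spec.1)

lemma windowRisk_windowLength_le (d : ℕ) (Δ : ℕ → ℝ) {n m : ℕ} (hm : m ≤ n) :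
    windowRisk d Δ (n + 1) (windowLength d Δ n) ≤ windowRisk d Δ (n + 1) m :=
  (exists_windowLength d Δ n).choose_spec.2 m (mem_range.2 (Nat.lt_succ_iff.2 hm))

/-- Each fixed `m` gives an average of at most `2 * d / (m + 1) + o(1)`. -/
lemma isLittleO_sum_of_le_windowRisk {d : ℕ} {Δ p : ℕ → ℝ}
    (hΔ : ∀ t, 2 ≤ t → 0 ≤ Δ t)
    (hΔ_sum : (fun T : ℕ => ∑ t ∈ Icc 2 T, Δ t) =o[atTop] (fun T : ℕ => (T : ℝ)))
    (hp0 : ∀ t, 0 ≤ p t) (hp1 : ∀ t, p t ≤ 1)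
    (hp : ∀ m t, m < t → p t ≤ windowRisk d Δ t m) :
    (fun T : ℕ => ∑ t ∈ Icc 1 T, p t) =o[atTop] (fun T : ℕ => (T : ℝ)) := by
  rw [isLittleO_iff]
  intro c hc
  obtain ⟨m, hm⟩ : ∃ m : ℕ, 2 * (d : ℝ) / (m + 1) ≤ c / 3 := by
    obtain ⟨m, hm⟩ := exists_nat_ge (2 * (d : ℝ) / (c / 3))
    refine ⟨m, ?_⟩
    rw [div_le_iff₀ (by positivity)] at hm ⊢
    nlinarith
  have hshift : ∀ T j, j < m →
      ∑ t ∈ Icc 1 T with m < t, Δ (t - j) ≤ ∑ t ∈ Icc 2 T, Δ t := by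
    intro T j hj
    have hinj : Set.InjOn (fun t => t - j) ({t ∈ Icc 1 T | m < t} : Finset ℕ) := by
      intro a ha b hb hab
      simp only [coe_filter, mem_Icc, Set.mem_ofPred_eq] at ha hb
      simp only at hab
      omega
    rw [← sum_image (f := Δ) hinj]
    refine sum_le_sum_of_subset_of_nonneg ?_ fun t ht _ => hΔ t (mem_Icc.1 ht).1
    intro r hr
    obtain ⟨t, ht, rfl⟩ := mem_image.1 hr
    simp only [mem_filter, mem_Icc] at ht
    rw [mem_Icc]
    omega
  have hbound : ∀ T : ℕ, ∑ t ∈ Icc 1 T, p t ≤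
      m + T * (c / 3) + m * m * ∑ t ∈ Icc 2 T, Δ t := by
    intro T
    rw [← sum_filter_add_sum_filter_not (Icc 1 T) (fun t => m < t)]
    have h1 : ∑ t ∈ Icc 1 T with ¬ m < t, p t ≤ m := by
      refine (sum_le_card_nsmul _ _ 1 fun t _ => hp1 t).trans ?_
      rw [nsmul_eq_mul, mul_one]
      have : #{t ∈ Icc 1 T | ¬ m < t} ≤ #(Icc 1 m) := by
        refine card_le_card fun t ht => ?_
        simp only [mem_filter, mem_Icc] at ht ⊢
        omega
      rw [Nat.card_Icc, Nat.add_sub_cancel] at this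
      exact_mod_cast this
    have h2 : ∑ t ∈ Icc 1 T with m < t, p t ≤ T * (c / 3) + m * m * ∑ t ∈ Icc 2 T, Δ t := by
      calc ∑ t ∈ Icc 1 T with m < t, p t
          ≤ ∑ t ∈ Icc 1 T with m < t, (c / 3 + m * ∑ j ∈ range m, Δ (t - j)) := by
            refine sum_le_sum fun t ht => (hp m t (mem_filter.1 ht).2).trans ?_
            rw [windowRisk]
            gcongr
        _ = #{t ∈ Icc 1 T | m < t} * (c / 3) +
              m * ∑ j ∈ range m, ∑ t ∈ Icc 1 T with m < t, Δ (t - j) := by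
            rw [sum_add_distrib, sum_const, nsmul_eq_mul, ← mul_sum, sum_comm]
        _ ≤ T * (c / 3) + m * (m * ∑ t ∈ Icc 2 T, Δ t) := by
            have hcard : #{t ∈ Icc 1 T | m < t} ≤ T :=
              (card_filter_le _ _).trans (by rw [Nat.card_Icc, Nat.add_sub_cancel])
            have hsum : ∑ j ∈ range m, ∑ t ∈ Icc 1 T with m < t, Δ (t - j) ≤
                m * ∑ t ∈ Icc 2 T, Δ t := by
              refine (sum_le_card_nsmul _ _ _ fun j hj => hshift T j (mem_range.1 hj)).trans ?_
              rw [card_range, nsmul_eq_mul]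
            gcongr
        _ = _ := by ring
    linarith
  have hev1 : ∀ᶠ T : ℕ in atTop, (m : ℝ) ≤ T * (c / 3) := by
    obtain ⟨N, hN⟩ := exists_nat_ge ((m : ℝ) / (c / 3))
    filter_upwards [eventually_ge_atTop N] with T hT
    rw [div_le_iff₀ (by positivity)] at hN
    refine hN.trans ?_
    gcongr
  have hev2 : ∀ᶠ T : ℕ in atTop, (m : ℝ) * m * ∑ t ∈ Icc 2 T, Δ t ≤ T * (c / 3) := by
    have hc' : 0 < c / 3 / (m * m + 1) := by positivity
    filter_upwards [isLittleO_iff.1 hΔ_sum hc'] with T hT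
    rw [Real.norm_natCast] at hT
    have hS := (le_abs_self _).trans hT
    calc (m : ℝ) * m * ∑ t ∈ Icc 2 T, Δ t
        ≤ (m * m + 1) * (c / 3 / (m * m + 1) * T) := by
          have h0 : 0 ≤ ∑ t ∈ Icc 2 T, Δ t := sum_nonneg fun t ht => hΔ t (mem_Icc.1 ht).1
          gcongr
          linarith
      _ = T * (c / 3) := by field_simp
  filter_upwards [hev1, hev2] with T h1 h2
  rw [Real.norm_natCast, Real.norm_of_nonneg (sum_nonneg fun t _ => hp0 t)]
  linarith [hbound T]

end Window

/-! ### The learner under drift -/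

section Drift

variable {𝒳 : Type*} [MeasurableSpace 𝒳] {C : Set (𝒳 → Bool)} {P : Measure 𝒳} {Δ : ℕ → ℝ}
  {h : ℕ → 𝒳 → Bool}

lemma measureReal_ne_le_sum [IsProbabilityMeasure P] (hh : h ∈ driftSequences C P Δ) {t : ℕ}
    (j : ℕ) (hj : j < t) :
    P.real {x | h (t - j) x ≠ h t x} ≤ ∑ i ∈ range j, Δ (t - i) := by
  induction j with
  | zero => simp
  | succ j ih =>
    have hstep := (hh (t - (j + 1)) (by omega)).2
    rw [show t - (j + 1) + 1 = t - j by omega] at hstep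
    have hsub : {x | h (t - (j + 1)) x ≠ h t x} ⊆
        {x | h (t - j) x ≠ h t x} ∪ {x | h (t - (j + 1)) x ≠ h (t - j) x} := by
      intro x hx
      by_contra hn
      simp only [Set.mem_union, Set.mem_ofPred_eq, not_or, not_not] at hx hn
      exact hx (hn.2.trans hn.1)
    rw [sum_range_succ]
    exact ((measureReal_mono hsub).trans (measureReal_union_le _ _)).trans
      (add_le_add (ih (by omega)) hstep)

end Drift

section Learner

variable {𝒳 : Type*}

open Classical in
/-- The learner that, from the `m` most recent observations for a window length `m` of least risk,
makes the one-inclusion prediction for the label of the new instance, which is put at the last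
coordinate with `false` as a dummy label. -/
def learner (C : Set (𝒳 → Bool)) (d : ℕ) (Δ : ℕ → ℝ) : LearningAlgorithm 𝒳 := fun n z x =>
  let w : Fin (windowLength d Δ n + 1) → 𝒳 × Bool := Fin.snoc (fun i =>
    z ⟨n - windowLength d Δ n + i, by have := windowLength_le d Δ n; omega⟩) (x, false)
  decide (PredictsTrue d (realizedPatterns C fun i => (w i).1) (labelSet fun i => (w i).2)
    (Fin.last _))

/-- The tuples of instances in a window starting at round `k`, with the labels given by `h`, on
which the one-inclusion prediction of the last label is wrong. -/
def wrongTuples (C : Set (𝒳 → Bool)) (d : ℕ) (h : ℕ → 𝒳 → Bool) (k m : ℕ) :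
    Set (Fin (m + 1) → 𝒳) :=
  {x | ¬ (PredictsTrue d (realizedPatterns C x) (labelSet fun i => h (k + i) (x i)) (Fin.last m) ↔
    Fin.last m ∈ labelSet fun i => h (k + i) (x i))}

lemma predictsTrue_congr {ι : Type*} [DecidableEq ι] [Fintype ι] {d : ℕ} {𝒜 : Finset (Finset ι)}
    {s s' : Finset ι} {i : ι} (h : ∀ j, j ≠ i → (j ∈ s ↔ j ∈ s')) :
    PredictsTrue d 𝒜 s i ↔ PredictsTrue d 𝒜 s' i := by
  have h1 : insert i s = insert i s' := by
    ext j
    by_cases hj : j = i <;> simp [hj, h]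
  have h2 : s.erase i = s'.erase i := by
    ext j
    by_cases hj : j = i <;> simp [hj, h]
  rw [PredictsTrue, PredictsTrue, h1, h2]

lemma mistakeEvent_learner (C : Set (𝒳 → Bool)) (d : ℕ) (Δ : ℕ → ℝ) (h : ℕ → 𝒳 → Bool) (n : ℕ) :
    mistakeEvent (learner C d Δ) h (n + 1) =
      (fun X i => X (n + 1 - windowLength d Δ n + i)) ⁻¹'
        wrongTuples C d h (n + 1 - windowLength d Δ n) (windowLength d Δ n) := by
  ext X
  set m := windowLength d Δ n with hm
  have hmn : m ≤ n := windowLength_le d Δ n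
  set w : Fin (m + 1) → 𝒳 × Bool := Fin.snoc (fun i : Fin m =>
    history h X (n + 1) ⟨n - m + i, by rw [Nat.add_sub_cancel]; omega⟩) (X (n + 1), false) with hw
  have hwX : (fun i => (w i).1) = fun i : Fin (m + 1) => X (n + 1 - m + i) := by
    funext i
    refine Fin.lastCases ?_ (fun i => ?_) i
    · simp only [hw, Fin.snoc_last, Fin.val_last]
      congr 1
      omega
    · simp only [hw, Fin.snoc_castSucc, history, Fin.val_castSucc]
      congr 1
      omega
  have hwY : ∀ j, j ≠ Fin.last m →
      (j ∈ labelSet (fun i => (w i).2) ↔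
        j ∈ labelSet fun i : Fin (m + 1) => h (n + 1 - m + i) (X (n + 1 - m + i))) := by
    intro j
    refine Fin.lastCases (fun hne => (hne rfl).elim) (fun i _ => ?_) j
    simp only [mem_labelSet, hw, Fin.snoc_castSucc, history, Fin.val_castSucc]
    rw [show n - m + i + 1 = n + 1 - m + i by omega]
  have hpred : prediction (learner C d Δ) h X (n + 1) = true ↔
      PredictsTrue d (realizedPatterns C fun i => (w i).1) (labelSet fun i => (w i).2)
        (Fin.last m) := by
    classical exact decide_eq_true_iff
  have hlast : n + 1 - m + m = n + 1 := by omega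
  rw [mistakeEvent, Set.mem_ofPred_eq, wrongTuples, Set.mem_preimage, Set.mem_ofPred_eq, ne_eq,
    Bool.eq_iff_iff, hpred, hwX, predictsTrue_congr hwY, mem_labelSet]
  simp only [Fin.val_last, hlast]

variable [MeasurableSpace 𝒳]

lemma nullMeasurableSet_wrongTuples {C : Set (𝒳 → Bool)} (hC_meas : ∀ h ∈ C, Measurable h)
    (hC : HasMeasurableTraces C) {P : Measure 𝒳} [IsProbabilityMeasure P] {Δ : ℕ → ℝ}
    {h : ℕ → 𝒳 → Bool} (hh : h ∈ driftSequences C P Δ) (d : ℕ) {k : ℕ} (hk : 1 ≤ k) (m : ℕ) :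
    NullMeasurableSet (wrongTuples C d h k m) (Measure.pi fun _ => P) :=
  nullMeasurableSet_patterns hC P
    (g := fun i => h (k + i)) (fun i => hC_meas _ (hh _ (by omega)).1)
    {p | ¬ (PredictsTrue d p.1 (labelSet p.2) (Fin.last m) ↔ Fin.last m ∈ labelSet p.2)}

/-- Unless some label in the window disagrees with the current target, the prediction is the one
that would be made if the current target had been the target throughout the window. -/
lemma measureReal_wrongTuples_le {d : ℕ} {C : Set (𝒳 → Bool)} (hC_meas : ∀ h ∈ C, Measurable h)
    (hC : HasMeasurableTraces C) (hd : ∀ s : Finset 𝒳, Shatters C s → #s ≤ d)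
    {P : Measure 𝒳} [IsProbabilityMeasure P] {Δ : ℕ → ℝ} (hΔ : ∀ t, 2 ≤ t → 0 ≤ Δ t)
    {h : ℕ → 𝒳 → Bool} (hh : h ∈ driftSequences C P Δ) {t m : ℕ} (hmt : m < t) :
    (Measure.pi fun _ => P).real (wrongTuples C d h (t - m) m) ≤ windowRisk d Δ t m := by
  have htC := (hh t (by omega)).1
  have hsub : wrongTuples C d h (t - m) m ⊆
      {x | Leaves d (realizedPatterns C x) (labelSet fun j => h t (x j)) (Fin.last m)} ∪
        ⋃ i : Fin m, Function.eval i.castSucc ⁻¹' {x | h (t - m + i) x ≠ h t x} := by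
    intro x hx
    by_contra hn
    simp only [Set.mem_union, Set.mem_iUnion, Set.mem_preimage, Set.mem_ofPred_eq, not_or,
      not_exists, not_not, Function.eval] at hn
    have hlab : (fun i : Fin (m + 1) => h (t - m + i) (x i)) = fun i => h t (x i) := by
      funext i
      refine Fin.lastCases ?_ (fun i => hn.2 i) i
      rw [Fin.val_last, Nat.sub_add_cancel hmt.le]
    rw [wrongTuples, Set.mem_ofPred_eq, hlab] at hx
    exact hn.1 (leaves_of_predictsTrue_iff hx)
  refine (measureReal_mono hsub).trans ((measureReal_union_le _ _).trans (add_le_add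
    (measureReal_leaves_last_le hC hd P htC (hC_meas _ htC)) ?_))
  refine (measureReal_iUnion_fintype_le _).trans ?_
  refine (sum_le_card_nsmul _ _ (∑ j ∈ range m, Δ (t - j)) fun i _ => ?_).trans ?_
  · have hmeas : MeasurableSet {x | h (t - m + i) x ≠ h t x} :=
      (measurableSet_eq_fun (hC_meas _ (hh _ (by omega)).1) (hC_meas _ htC)).compl
    rw [measureReal_def,
      (measurePreserving_eval (fun _ : Fin (m + 1) => P) i.castSucc).measure_preimage
        hmeas.nullMeasurableSet, ← measureReal_def]
    have hdrift := measureReal_ne_le_sum hh (m - i) (t := t) (by omega)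
    rw [show t - (m - i) = t - m + i by omega] at hdrift
    refine hdrift.trans (sum_le_sum_of_subset_of_nonneg (range_mono (by omega)) fun j hj _ => ?_)
    have := mem_range.1 hj
    exact hΔ _ (by omega)
  · simp

end Learner

lemma exists_card_le_of_vcDim_lt_top {𝒳 : Type*} {C : Set (𝒳 → Bool)} (hC : vcDim C < ⊤) :
    ∃ d : ℕ, ∀ s : Finset 𝒳, Shatters C s → #s ≤ d := by
  obtain ⟨d, hd⟩ := ENat.ne_top_iff_exists.1 hC.ne
  refine ⟨d, fun s hs => ?_⟩
  have : (#s : ℕ∞) ≤ vcDim C := le_iSup₂ (f := fun (s : Finset 𝒳) (_ : Shatters C s) =>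
    (#s : ℕ∞)) s hs
  rw [← hd] at this
  exact_mod_cast this

lemma integral_numMistakes {𝒳 : Type*} [MeasurableSpace 𝒳] {P : Measure 𝒳}
    [IsProbabilityMeasure P] {A : LearningAlgorithm 𝒳} {h : ℕ → 𝒳 → Bool}
    (hA : ∀ t, 1 ≤ t → NullMeasurableSet (mistakeEvent A h t) (dataLaw P)) (T : ℕ) :
    ∫ X, numMistakes A h T X ∂(dataLaw P) =
      ∑ t ∈ Icc 1 T, (dataLaw P).real (mistakeEvent A h t) := by
  have : IsProbabilityMeasure (dataLaw P) := by
    unfold dataLaw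
    infer_instance
  unfold numMistakes
  rw [integral_finsetSum _ fun t ht =>
    (integrable_const (1 : ℝ)).indicator₀ (hA t (mem_Icc.1 ht).1)]
  refine sum_congr rfl fun t ht => ?_
  rw [integral_indicator₀ (hA t (mem_Icc.1 ht).1)]
  simp

end DriftingConcept

end

theorem corollary1 {𝒳 : Type*} [MeasurableSpace 𝒳] (C : Set (𝒳 → Bool))
    (hC_meas : ∀ h ∈ C, Measurable h)
    (hC_traces : DriftingConcept.HasMeasurableTraces C)
    (hd_pos : 1 ≤ DriftingConcept.vcDim C)
    (hd_fin : DriftingConcept.vcDim C < ⊤)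
    (Δ : ℕ → ℝ) (hΔ : ∀ t, 2 ≤ t → Δ t ∈ Set.Icc (0 : ℝ) 1)
    (hΔ_sum : (fun T : ℕ => ∑ t ∈ Finset.Icc 2 T, Δ t) =o[atTop] (fun T : ℕ => (T : ℝ))) :
    ∃ A : DriftingConcept.LearningAlgorithm 𝒳,
      ∀ (P : Measure 𝒳) [IsProbabilityMeasure P],
        ∀ h ∈ DriftingConcept.driftSequences C P Δ,
          (∀ t, 1 ≤ t →
            NullMeasurableSet (DriftingConcept.mistakeEvent A h t) (DriftingConcept.dataLaw P)) ∧
          (fun T : ℕ => ∫ X, DriftingConcept.numMistakes A h T X ∂(DriftingConcept.dataLaw P))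
            =o[atTop] (fun T : ℕ => (T : ℝ)) := by
  open DriftingConcept in
  obtain ⟨d, hd⟩ := exists_card_le_of_vcDim_lt_top hd_fin
  have hΔ0 : ∀ t, 2 ≤ t → 0 ≤ Δ t := fun t ht => (hΔ t ht).1
  refine ⟨learner C d Δ, fun P _ h hh => ?_⟩
  have : IsProbabilityMeasure (dataLaw P) := by
    unfold dataLaw
    infer_instance
  have hwin : ∀ n, 1 ≤ n + 1 - windowLength d Δ n := fun n => by
    have := windowLength_le d Δ n
    omega
  have hnull : ∀ n, NullMeasurableSet (wrongTuples C d h (n + 1 - windowLength d Δ n)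
      (windowLength d Δ n)) (Measure.pi fun _ => P) := fun n =>
    nullMeasurableSet_wrongTuples hC_meas hC_traces hh d (hwin n) _
  have hmeas : ∀ t, 1 ≤ t → NullMeasurableSet (mistakeEvent (learner C d Δ) h t) (dataLaw P) := by
    intro t ht
    obtain ⟨n, rfl⟩ := Nat.exists_eq_add_of_le' ht
    rw [mistakeEvent_learner]
    exact (hnull n).preimage (measurePreserving_window P _ _).quasiMeasurePreserving
  refine ⟨hmeas, ?_⟩
  simp only [integral_numMistakes hmeas]
  refine isLittleO_sum_of_le_windowRisk (d := d) hΔ0 hΔ_sum (fun t => measureReal_nonneg)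
    (fun t => measureReal_le_one) fun m t hmt => ?_
  obtain ⟨n, rfl⟩ := Nat.exists_eq_add_of_le' (show 1 ≤ t by omega)
  rw [mistakeEvent_learner, measureReal_def,
    (measurePreserving_window P _ _).measure_preimage (hnull n), ← measureReal_def]
  exact (measureReal_wrongTuples_le hC_meas hC_traces hd hΔ0 hh
    (Nat.lt_succ_of_le (windowLength_le d Δ n))).trans
    (windowRisk_windowLength_le d Δ (Nat.lt_succ_iff.1 hmt))
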